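/- Let $\mathcal{X}$ be a connected graph (loops and multiple edges allowed), regarded as a geodesic metric space with the path metric $d_{\mathcal{X}}$ in which every edge has length one, and let $\mathcal{X}^0$ be its set of vertices. Call $\mathcal{X}$ *Gromov hyperbolic* if there is $\delta \ge 0$ such that for any three points $x, y, z \in \mathcal{X}$ (vertices or points in the interior of edges) and any geodesics $k = [x,y]$, $g = [y,z]$, $h = [z,x]$, the $\delta$-neighborhood of the union of any two of $k, g, h$ contains the third. Here a geodesic $[x,y]$ is the image of an isometric embedding of a compact real interval whose endpoints are sent to $x$ and $y$ respectively. Then $\mathcal{X}$ is Gromov hyperbolic if and only if there are a constant $M \geq 0$ and, for every unordered pair $x, y \in \mathcal{X}^0$ (the case $x = y$ included), a connected subgraph $g_{x,y} \subset \mathcal{X}$ containing $x$ and $y$, such that: 1. (Local) for all $x, y \in \mathcal{X}^0$, if $d_{\mathcal{X}}(x,y) \leq 1$ then $g_{x,y}$ has diameter at most $M$ in $d_{\mathcal{X}}$; 2. (Slim triangles) for all $x, y, z \in \mathcal{X}^0$, the subgraph $g_{x,y}$ is contained in the $M$-neighborhood of $g_{y,z} \cup g_{z,x}$. Neighborhoods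 are closed: the $r$-neighborhood of a set $A$ is the set of points at distance at most $r$ from $A$. -/

import Mathlib

open scoped Graph

noncomputable section

namespace UnitEdgeGraph

variable {α β : Type*}

/-! ### The metric graph with all edges of length one

A graph is a multigraph `G : Graph α β`; loops and multiple edges are allowed. -/

/-- The initial vertex of an edge, for an arbitrary fixed orientation of each edge. -/
def source {G : Graph α β} (e : E(G)) : V(G) :=
  ⟨(Graph.exists_isLink_of_mem_edgeSet e.2).choose,
    (Graph.exists_isLink_of_mem_edgeSet e.2).choose_spec.choose_spec.left_mem⟩

/-- The terminal vertex of an edge, for the same orientation. -/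
def target {G : Graph α β} (e : E(G)) : V(G) :=
  ⟨(Graph.exists_isLink_of_mem_edgeSet e.2).choose_spec.choose,
    (Graph.exists_isLink_of_mem_edgeSet e.2).choose_spec.choose_spec.right_mem⟩

theorem isLink_source_target {G : Graph α β} (e : E(G)) :
    G.IsLink e.1 (source e).1 (target e).1 :=
  (Graph.exists_isLink_of_mem_edgeSet e.2).choose_spec.choose_spec

/-- The points of the geometric realization of `G`: the vertices, and for each edge `e` the
interior points of `e`; `inner e t` lies at distance `t` along `e` from `source e`. -/
inductive Point (G : Graph α β) where
  | vertex (v : V(G)) : Point G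
  | inner (e : E(G)) (t : Set.Ioo (0 : ℝ) 1) : Point G

namespace Point

variable {G : Graph α β}

/-- The two ends of the edge that contains an interior point; for a vertex, the vertex itself. -/
def foot : Point G → Bool → V(G)
  | vertex v, _ => v
  | inner e _, false => source e
  | inner e _, true => target e

/-- The length of the part of the edge between a point and each of its two feet. -/
def footDist : Point G → Bool → ℝ
  | vertex _, _ => 0
  | inner _ t, false => t
  | inner _ t, true => 1 - t

/-- The least length of a path from `p` to `q` that passes through a foot of `p` and a foot of `q`.
The distance of two vertices is the least number of edges of a walk between them. -/
def outerDist (p q : Point G) : ℝ :=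
  ⨅ i : Bool × Bool,
    p.footDist i.1 + (G.toSimpleGraph.dist (p.foot i.1) (q.foot i.2) : ℝ) + q.footDist i.2

open Classical in
/-- The path metric in which every edge has length one: a shortest path between two points either
passes through feet of both, or (for two points in the interior of the same edge) stays in the
interior of that edge. -/
def pathDist : Point G → Point G → ℝ
  | inner e s, inner f t =>
      if e = f then min |(s : ℝ) - t| (outerDist (inner e s) (inner f t))
      else outerDist (inner e s) (inner f t)
  | p, q => outerDist p q

theorem footDist_nonneg (p : Point G) (i : Bool) : 0 ≤ p.footDist i := by
  rcases p with v | ⟨e, t, h0, h1⟩ <;> cases i <;> simp [footDist] <;> linarith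

theorem outerDist_le (p q : Point G) (i j : Bool) :
    outerDist p q ≤
      p.footDist i + (G.toSimpleGraph.dist (p.foot i) (q.foot j) : ℝ) + q.footDist j :=
  ciInf_le (f := fun i : Bool × Bool =>
    p.footDist i.1 + (G.toSimpleGraph.dist (p.foot i.1) (q.foot i.2) : ℝ) + q.footDist i.2)
    (Set.finite_range _).bddBelow (i, j)

theorem exists_outerDist_eq (p q : Point G) : ∃ i j : Bool,
    outerDist p q =
      p.footDist i + (G.toSimpleGraph.dist (p.foot i) (q.foot j) : ℝ) + q.footDist j := by
  obtain ⟨i, hi⟩ := exists_eq_ciInf_of_finite (f := fun i : Bool × Bool =>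
    p.footDist i.1 + (G.toSimpleGraph.dist (p.foot i.1) (q.foot i.2) : ℝ) + q.footDist i.2)
  exact ⟨i.1, i.2, hi.symm⟩

theorem outerDist_nonneg (p q : Point G) : 0 ≤ outerDist p q := by
  obtain ⟨i, j, h⟩ := exists_outerDist_eq p q
  have := footDist_nonneg p i
  have := footDist_nonneg q j
  rw [h]
  positivity

theorem outerDist_comm (p q : Point G) : outerDist p q = outerDist q p := by
  have key : ∀ p q : Point G, outerDist p q ≤ outerDist q p := by
    intro p q
    obtain ⟨i, j, h⟩ := exists_outerDist_eq q p
    have := outerDist_le p q j i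
    rw [SimpleGraph.dist_comm] at this
    linarith
  exact le_antisymm (key p q) (key q p)

theorem pathDist_le_outerDist (p q : Point G) : pathDist p q ≤ outerDist p q := by
  rcases p with v | ⟨e, s⟩ <;> rcases q with w | ⟨f, t⟩ <;> simp only [pathDist, le_refl]
  split_ifs
  · exact min_le_right _ _
  · exact le_rfl

theorem pathDist_inner_le (e : E(G)) (s t : Set.Ioo (0 : ℝ) 1) :
    pathDist (inner e s) (inner e t) ≤ |(s : ℝ) - t| := by
  simp [pathDist]

theorem pathDist_cases (p q : Point G) :
    pathDist p q = outerDist p q ∨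
      ∃ e s t, p = inner e s ∧ q = inner e t ∧ pathDist p q = |(s : ℝ) - t| := by
  rcases p with v | ⟨e, s⟩ <;> rcases q with w | ⟨f, t⟩ <;> try exact Or.inl rfl
  by_cases h : e = f
  · subst h
    simp only [pathDist, if_true]
    rcases min_choice |(s : ℝ) - t| (outerDist (inner e s) (inner e t)) with h | h
    · exact Or.inr ⟨e, s, t, rfl, rfl, h⟩
    · exact Or.inl h
  · exact Or.inl (by simp [pathDist, h])

theorem footDist_inner_le (e : E(G)) (s t : Set.Ioo (0 : ℝ) 1) (i : Bool) :
    (inner e s : Point G).footDist i ≤ |(s : ℝ) - t| + (inner e t : Point G).footDist i := by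
  cases i <;> simp only [footDist]
  · linarith [le_abs_self ((s : ℝ) - t)]
  · linarith [neg_abs_le ((s : ℝ) - t)]

theorem foot_inner_eq (e : E(G)) (s t : Set.Ioo (0 : ℝ) 1) (i : Bool) :
    (inner e s : Point G).foot i = (inner e t : Point G).foot i := by
  cases i <;> rfl

theorem dist_source_target_le (e : E(G)) :
    G.toSimpleGraph.dist (source e) (target e) ≤ 1 := by
  by_cases h : source e = target e
  · simp [h]
  · have hadj : G.toSimpleGraph.Adj (source e) (target e) := by
      rw [Graph.toSimpleGraph_adj]
      exact ⟨h, (isLink_source_target e).adj⟩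
    exact (SimpleGraph.dist_eq_one_iff_adj.2 hadj).le

theorem dist_foot_le (p : Point G) (i j : Bool) :
    (G.toSimpleGraph.dist (p.foot i) (p.foot j) : ℝ) ≤ p.footDist i + p.footDist j := by
  by_cases hij : i = j
  · subst hij
    have := footDist_nonneg p i
    simp only [SimpleGraph.dist_self, Nat.cast_zero]
    linarith
  · rcases p with v | ⟨e, t⟩
    · simp [foot, footDist]
    · have h : (G.toSimpleGraph.dist (source e) (target e) : ℝ) ≤ 1 := by
        exact_mod_cast dist_source_target_le e
      cases i <;> cases j <;> simp only [foot, footDist] <;> first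
        | exact absurd rfl hij
        | linarith
        | (rw [SimpleGraph.dist_comm]; linarith)

theorem pathDist_self (p : Point G) : pathDist p p = 0 := by
  rcases p with v | ⟨e, t⟩
  · obtain ⟨i, j, h⟩ := exists_outerDist_eq (vertex v) (vertex v)
    change outerDist (vertex v) (vertex v) = 0
    simpa [foot, footDist] using h
  · simpa [pathDist] using outerDist_nonneg _ _

theorem pathDist_comm (p q : Point G) : pathDist p q = pathDist q p := by
  rcases p with v | ⟨e, s⟩ <;> rcases q with w | ⟨f, t⟩ <;>
    simp only [pathDist] <;> try exact outerDist_comm _ _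
  by_cases h : e = f
  · subst h
    simp only [if_true]
    rw [outerDist_comm, abs_sub_comm]
  · rw [if_neg h, if_neg (Ne.symm h), outerDist_comm]

theorem pathDist_triangle (hG : G.toSimpleGraph.Preconnected) (p q r : Point G) :
    pathDist p r ≤ pathDist p q + pathDist q r := by
  have mixed : ∀ (e : E(G)) (s t : Set.Ioo (0 : ℝ) 1) (r : Point G),
      pathDist (inner e s) r ≤ |(s : ℝ) - t| + outerDist (inner e t) r := by
    intro e s t r
    obtain ⟨i, j, h⟩ := exists_outerDist_eq (inner e t) r
    have h1 := outerDist_le (inner e s) r i j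
    have h2 := footDist_inner_le e s t i
    rw [foot_inner_eq e s t i] at h1
    linarith [pathDist_le_outerDist (inner e s) r]
  rcases pathDist_cases p q with h1 | ⟨e, s, t, rfl, rfl, h1⟩
  · rcases pathDist_cases q r with h2 | ⟨e, s, t, rfl, rfl, h2⟩
    · obtain ⟨i, j, h3⟩ := exists_outerDist_eq p q
      obtain ⟨k, l, h4⟩ := exists_outerDist_eq q r
      have h5 := outerDist_le p r i l
      have h6 := dist_foot_le q j k
      have h7 : (G.toSimpleGraph.dist (p.foot i) (r.foot l) : ℝ) ≤
          G.toSimpleGraph.dist (p.foot i) (q.foot j) +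
            G.toSimpleGraph.dist (q.foot j) (q.foot k) +
            G.toSimpleGraph.dist (q.foot k) (r.foot l) := by
        have a := SimpleGraph.Reachable.dist_triangle_left (hG (p.foot i) (q.foot j)) (r.foot l)
        have b := SimpleGraph.Reachable.dist_triangle_left (hG (q.foot j) (q.foot k)) (r.foot l)
        norm_cast
        omega
      linarith [pathDist_le_outerDist p r]
    · have := mixed e t s p
      rw [pathDist_comm p, h1, h2, outerDist_comm p, abs_sub_comm]
      linarith
  · rcases pathDist_cases (inner e t) r with h2 | ⟨e', t', u, h, rfl, h2⟩
    · linarith [mixed e s t r]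
    · obtain ⟨rfl, rfl⟩ := Point.inner.inj h
      linarith [pathDist_inner_le e s u, abs_sub_le (s : ℝ) t u]

theorem eq_of_pathDist_eq_zero (hG : G.toSimpleGraph.Preconnected) {p q : Point G}
    (h : pathDist p q = 0) : p = q := by
  rcases pathDist_cases p q with h1 | ⟨e, s, t, rfl, rfl, h1⟩
  · obtain ⟨i, j, h2⟩ := exists_outerDist_eq p q
    have hp := footDist_nonneg p i
    have hq := footDist_nonneg q j
    have hd : (0 : ℝ) ≤ G.toSimpleGraph.dist (p.foot i) (q.foot j) := Nat.cast_nonneg _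
    have hp0 : p.footDist i = 0 := by linarith
    have hq0 : q.footDist j = 0 := by linarith
    have hd0 : (G.toSimpleGraph.dist (p.foot i) (q.foot j) : ℝ) = 0 := by linarith
    have vert : ∀ (p : Point G) (i : Bool), p.footDist i = 0 → p = vertex (p.foot i) := by
      intro p i h
      rcases p with v | ⟨e, t, ht0, ht1⟩
      · rfl
      · cases i <;> simp only [footDist] at h <;> linarith
    rw [vert p i hp0, vert q j hq0,
      ((hG (p.foot i) (q.foot j)).dist_eq_zero_iff).1 (by exact_mod_cast hd0)]
  · have : (s : ℝ) = t := by
      rw [h1, abs_eq_zero] at h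
      linarith
    rw [Subtype.ext this]

/-- A connected graph is a metric space when all its edges have length one. -/
instance instMetricSpace [hG : Fact G.toSimpleGraph.Preconnected] : MetricSpace (Point G) where
  dist := pathDist
  dist_self := pathDist_self
  dist_comm := pathDist_comm
  dist_triangle := pathDist_triangle hG.out
  eq_of_dist_eq_zero := eq_of_pathDist_eq_zero hG.out

end Point

/-- The points of the realization of `G` that lie in the subgraph `H`. -/
def carrier (G H : Graph α β) : Set (Point G) :=
  {p | match p with
    | .vertex v => v.1 ∈ V(H)
    | .inner e _ => e.1 ∈ E(H)}

/-! ### Gromov hyperbolicity -/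

/-- `S` is the image of a geodesic from `x` to `y`, that is, of an isometric embedding
`f : [u, v] → X` with `f u = x` and `f v = y`. -/
def IsGeodesic {X : Type*} [MetricSpace X] (x y : X) (S : Set X) : Prop :=
  ∃ (u v : ℝ) (f : ℝ → X), u ≤ v ∧ f u = x ∧ f v = y ∧
    (∀ s ∈ Set.Icc u v, ∀ t ∈ Set.Icc u v, dist (f s) (f t) = |s - t|) ∧
    S = f '' Set.Icc u v

/-- Every geodesic triangle is `δ`-slim: the `δ`-neighborhood of any two sides contains the
third. -/
def IsHyperbolic (δ : ℝ) (X : Type*) [MetricSpace X] : Prop :=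
  ∀ (x y z : X) (k g h : Set X), IsGeodesic x y k → IsGeodesic y z g → IsGeodesic z x h →
    k ⊆ Metric.cthickening δ (g ∪ h) ∧
    g ⊆ Metric.cthickening δ (h ∪ k) ∧
    h ⊆ Metric.cthickening δ (k ∪ g)

/-- `X` is Gromov hyperbolic if it is `δ`-hyperbolic for some `δ ≥ 0`. -/
def IsGromovHyperbolic (X : Type*) [MetricSpace X] : Prop :=
  ∃ δ : ℝ, 0 ≤ δ ∧ IsHyperbolic δ X

end UnitEdgeGraph

end

/-!
A connected graph is hyperbolic as soon as it carries a family of connected subgraphs, one for each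
pair of vertices, that is locally bounded and forms slim triangles: such subgraphs are uniformly
close to geodesics.

*The criterion implies hyperbolicity.* This direction takes place in an arbitrary metric space with
a family of sets `L p q` that is slim in the sense of `IsSlimFamily`; the subgraphs `g x y` give such
a family on the points of the metric graph (`isSlimFamily_carrier`). Halving a geodesic of length at
most `2 ^ n` repeatedly shows that `L p q` is within `B * (n + 1)` of every geodesic from `p` to `q`
(`IsSlimFamily.exists_dist_le_of_length_le_two_pow`). If some bound `D`, whatever its origin, holds
on all segments of a geodesic, then a point of `L p q` is not affected by what happens farther than
about `2 * D` along the geodesic, so that the logarithmic bound for a segment of length about `4 * D`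
takes the place of `D` (`IsSlimFamily.exists_dist_le_improve`). As logarithms grow more slowly than
linearly, repeated improvement ends at a bound that depends only on `B`
(`IsSlimFamily.exists_forall_exists_dist_le`). Since `L p q` is coarsely connected, conversely every
geodesic is close to it (`IsSlimFamily.exists_mem_dist_le`), and slimness passes from `L` to the
geodesic triangles (`IsSlimFamily.isGromovHyperbolic`).

*Hyperbolicity implies the criterion.* The subgraph assigned to `x` and `y` is induced by the
vertices that lie on some geodesic from `x` to `y` (`intervalGraph`). It is symmetric in `x` and `y`
without any choice of geodesics. A geodesic through a given vertex of it is obtained by joining two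
shortest walks (`exists_isGeodesic_mem`), and every geodesic between vertices stays within distance
one of the interval (`exists_foot_dist_add_dist`), so slim geodesic triangles yield slim triangles
of intervals (`carrier_intervalGraph_subset`).
-/

namespace UnitEdgeGraph

/-! ### Coarsely slim families of sets in a metric space -/

/-- A family of sets `L p q`, one for each pair of points of a metric space, that satisfies with
constant `B` the hypotheses of the criterion: `L p q` is symmetric in `p` and `q`, contains both,
is bounded when `p` and `q` are close, forms slim triangles, and is coarsely connected, in the
sense that a set containing `p` but not `q` is left somewhere within `L p q` by a jump of length
at most `B`. -/
structure IsSlimFamily {X : Type*} [MetricSpace X] (L : X → X → Set X) (B : ℝ) : Prop where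
  nonneg : 0 ≤ B
  symm : ∀ p q, L p q = L q p
  right_mem : ∀ p q, q ∈ L p q
  dist_le : ∀ p q, dist p q ≤ 1 → ∀ v ∈ L p q, dist p v ≤ B
  slim : ∀ p q r, ∀ v ∈ L p q, ∃ w ∈ L q r ∪ L r p, dist v w ≤ B
  exists_jump : ∀ p q, ∀ S : Set X, p ∈ S → q ∉ S →
    ∃ a ∈ L p q, ∃ b ∈ L p q, a ∈ S ∧ b ∉ S ∧ dist a b ≤ B

namespace IsSlimFamily

variable {X : Type*} [MetricSpace X] {L : X → X → Set X} {B : ℝ}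

/-- Halving a geodesic of length at most `2 ^ n` repeatedly, `n` slim triangles lead from a point of
`L` between its ends to a point of `L` between two points of the geodesic at distance at most one. -/
theorem exists_dist_le_of_length_le_two_pow (hL : IsSlimFamily L B) (n : ℕ) :
    ∀ {u v : ℝ} {f : ℝ → X}, u ≤ v →
      (∀ s ∈ Set.Icc u v, ∀ t ∈ Set.Icc u v, dist (f s) (f t) = |s - t|) → v - u ≤ 2 ^ n →
      ∀ w ∈ L (f u) (f v), ∃ r ∈ Set.Icc u v, dist w (f r) ≤ B * (n + 1) := by
  induction n with
  | zero =>
    intro u v f huv hf hn w hw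
    refine ⟨u, ⟨le_rfl, huv⟩, ?_⟩
    have h1 : dist (f u) (f v) ≤ 1 := by
      rw [hf u ⟨le_rfl, huv⟩ v ⟨huv, le_rfl⟩, abs_sub_comm, abs_of_nonneg (by linarith)]
      simpa using hn
    rw [dist_comm]
    simpa using hL.dist_le _ _ h1 w hw
  | succ n ih =>
    intro u v f huv hf hn w hw
    obtain ⟨w', hw', hww'⟩ := hL.slim _ _ (f ((u + v) / 2)) w hw
    have hhalf : (v - u) / 2 ≤ 2 ^ n := by rw [pow_succ] at hn; linarith
    have key : ∃ r ∈ Set.Icc u v, dist w' (f r) ≤ B * (n + 1) := by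
      rcases hw' with hw' | hw'
      · rw [hL.symm] at hw'
        obtain ⟨r, hr, h⟩ := ih (u := (u + v) / 2) (v := v) (by linarith)
          (fun s hs t ht => hf s ⟨by linarith [hs.1], hs.2⟩ t ⟨by linarith [ht.1], ht.2⟩)
          (by linarith) w' hw'
        exact ⟨r, ⟨by linarith [hr.1], hr.2⟩, h⟩
      · rw [hL.symm] at hw'
        obtain ⟨r, hr, h⟩ := ih (u := u) (v := (u + v) / 2) (by linarith)
          (fun s hs t ht => hf s ⟨hs.1, by linarith [hs.2]⟩ t ⟨ht.1, by linarith [ht.2]⟩)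
          (by linarith) w' hw'
        exact ⟨r, ⟨hr.1, by linarith [hr.2]⟩, h⟩
    obtain ⟨r, hr, h⟩ := key
    refine ⟨r, hr, (dist_triangle w w' (f r)).trans ?_⟩
    push_cast
    linarith

/-- If `L` stays within `D` of every segment of a geodesic, then only the part of `L` over a
segment of length at most `4 * D + 4 * B + 2` matters, because the rest of `L` is too far away. The
logarithmic bound on that segment then replaces `D`. -/
theorem exists_dist_le_improve (hL : IsSlimFamily L B) {a b : ℝ} {f : ℝ → X}
    (hf : ∀ s ∈ Set.Icc a b, ∀ t ∈ Set.Icc a b, dist (f s) (f t) = |s - t|) {D : ℝ} {n : ℕ}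
    (hn : 4 * D + 4 * B + 2 ≤ 2 ^ n)
    (hD : ∀ u v, a ≤ u → u ≤ v → v ≤ b → ∀ w ∈ L (f u) (f v),
      ∃ r ∈ Set.Icc u v, dist w (f r) ≤ D)
    {u v : ℝ} (hau : a ≤ u) (huv : u ≤ v) (hvb : v ≤ b) {w : X} (hw : w ∈ L (f u) (f v)) :
    ∃ r ∈ Set.Icc u v, dist w (f r) ≤ B * (n + 3) := by
  have hB := hL.nonneg
  obtain ⟨s, hs, hws⟩ := hD u v hau huv hvb w hw
  have hD0 : 0 ≤ D := dist_nonneg.trans hws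
  set l := 2 * D + 2 * B + 1 with hl
  set x := max u (s - l) with hx
  set y := min v (s + l) with hy
  have hux : u ≤ x := le_max_left _ _
  have hxs : x ≤ s := max_le hs.1 (by linarith)
  have hsy : s ≤ y := le_min hs.2 (by linarith)
  have hyv : y ≤ v := min_le_left _ _
  have hBn : 0 ≤ B * n := by positivity
  -- A point of `L` over a part of the geodesic that avoids the `l`-neighborhood of `s` is too far.
  have far : ∀ c d, a ≤ c → c ≤ d → d ≤ b → (∀ t ∈ Set.Icc c d, l ≤ |s - t|) →
      ∀ q ∈ L (f c) (f d), ¬ dist w q ≤ 2 * B := by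
    intro c d hc hcd hd hst q hq hwq
    obtain ⟨t, ht, hqt⟩ := hD c d hc hcd hd q hq
    have h1 := hst t ht
    rw [← hf s ⟨hau.trans hs.1, hs.2.trans hvb⟩ t ⟨hc.trans ht.1, ht.2.trans hd⟩] at h1
    have h2 := dist_triangle4 (f s) w q (f t)
    rw [dist_comm (f s) w] at h2
    linarith
  -- A point of `L` over a degenerate part of the geodesic is close to that part.
  have degen : ∀ c ∈ Set.Icc u v, ∀ q ∈ L (f c) (f c), dist w q ≤ 2 * B →
      ∃ r ∈ Set.Icc u v, dist w (f r) ≤ B * (n + 3) := by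
    intro c hc q hq hwq
    refine ⟨c, hc, ?_⟩
    have h1 := hL.dist_le (f c) (f c) (by simp) q hq
    have h2 := dist_triangle_right w (f c) q
    linarith
  obtain ⟨q, hq, hwq⟩ := hL.slim _ _ (f x) w hw
  rcases hq with hq | hq
  · obtain ⟨q', hq', hqq'⟩ := hL.slim _ _ (f y) q hq
    have hwq' : dist w q' ≤ 2 * B := by linarith [dist_triangle w q q']
    rcases hq' with hq' | hq'
    · -- The relevant part of the geodesic has length at most `2 * l`.
      have hxl : s - l ≤ x := le_max_right _ _
      have hyl : y ≤ s + l := min_le_right _ _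
      obtain ⟨r, hr, h⟩ := hL.exists_dist_le_of_length_le_two_pow n (hxs.trans hsy)
        (fun s hs t ht => hf s ⟨by linarith [hs.1], by linarith [hs.2]⟩ t
          ⟨by linarith [ht.1], by linarith [ht.2]⟩) (by linarith) q' hq'
      exact ⟨r, ⟨hux.trans hr.1, hr.2.trans hyv⟩, by linarith [dist_triangle w q' (f r)]⟩
    · rcases le_total v (s + l) with h | h
      · rw [show y = v from min_eq_left h] at hq'
        exact degen v ⟨huv, le_rfl⟩ q' hq' hwq'
      · have hy' : y = s + l := min_eq_right h
        refine absurd hwq' (far y v (by linarith) hyv hvb (fun t ht => ?_) q' hq')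
        rw [abs_sub_comm]
        exact le_trans (by linarith [ht.1]) (le_abs_self _)
  · have hwq' : dist w q ≤ 2 * B := by linarith
    rw [hL.symm] at hq
    rcases le_total (s - l) u with h | h
    · rw [show x = u from max_eq_left h] at hq
      exact degen u ⟨le_rfl, huv⟩ q hq hwq'
    · have hx' : x = s - l := max_eq_right h
      refine absurd hwq' (far u x hau hux (by linarith) (fun t ht => ?_) q hq)
      exact le_trans (by linarith [ht.2]) (le_abs_self _)

/-- The constant comes from comparing logarithmic with linear growth: by the improvement lemma a
bound `2 ^ (j + 1)` for all segments of a geodesic yields the bound `2 ^ j`, as long as `j` is at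
least a number that depends only on `B`. -/
theorem exists_forall_exists_dist_le (hL : IsSlimFamily L B) :
    ∃ K, 0 ≤ K ∧ ∀ (u v : ℝ) (f : ℝ → X), u ≤ v →
      (∀ s ∈ Set.Icc u v, ∀ t ∈ Set.Icc u v, dist (f s) (f t) = |s - t|) →
      ∀ w ∈ L (f u) (f v), ∃ r ∈ Set.Icc u v, dist w (f r) ≤ K := by
  have hB := hL.nonneg
  have hlim : Filter.Tendsto (fun j : ℕ => B * ((j : ℝ) ^ 1 / 2 ^ j) + 8 * B * (1 / 2) ^ j)
      Filter.atTop (nhds (B * 0 + 8 * B * 0)) :=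
    ((tendsto_pow_const_div_const_pow_of_one_lt 1 (by norm_num : (1 : ℝ) < 2)).const_mul B).add
      ((tendsto_pow_atTop_nhds_zero_of_lt_one (by norm_num) (by norm_num)).const_mul _)
  have hev : ∀ᶠ j : ℕ in Filter.atTop, B * (j + 8) ≤ 2 ^ j := by
    filter_upwards [hlim.eventually (gt_mem_nhds (by norm_num : B * 0 + 8 * B * 0 < 1))] with j hj
    have h2 : (0 : ℝ) < 2 ^ j := by positivity
    have : B * ((j : ℝ) ^ 1 / 2 ^ j) + 8 * B * (1 / 2) ^ j = B * (j + 8) / 2 ^ j := by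
      rw [one_div, inv_pow]
      field_simp
    rw [this, div_lt_one h2] at hj
    exact hj.le
  obtain ⟨j₀, hj₀⟩ := Filter.eventually_atTop.1 hev
  refine ⟨2 ^ j₀, by positivity, fun a b f hab hf => ?_⟩
  let P : ℝ → Prop := fun D => ∀ u v, a ≤ u → u ≤ v → v ≤ b → ∀ w ∈ L (f u) (f v),
    ∃ r ∈ Set.Icc u v, dist w (f r) ≤ D
  have step : ∀ j, j₀ ≤ j → P (2 ^ (j + 1)) → P (2 ^ j) := by
    intro j hj hP u v hau huv hvb w hw
    have h1 := hj₀ j hj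
    have hBj : 0 ≤ B * j := by positivity
    have hone : (1 : ℝ) ≤ 2 ^ j := one_le_pow₀ (by norm_num)
    obtain ⟨r, hr, h⟩ := hL.exists_dist_le_improve hf (D := 2 ^ (j + 1)) (n := j + 4)
      (by rw [pow_succ, pow_add]; linarith) hP hau huv hvb hw
    refine ⟨r, hr, h.trans ?_⟩
    push_cast
    linarith
  have start : ∃ j, P (2 ^ (j₀ + j)) := by
    obtain ⟨n, hn⟩ := pow_unbounded_of_one_lt (b - a) (by norm_num : (1 : ℝ) < 2)
    refine ⟨n, fun u v hau huv hvb w hw => ?_⟩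
    obtain ⟨r, hr, h⟩ := hL.exists_dist_le_of_length_le_two_pow (j₀ + n) huv
      (fun s hs t ht => hf s ⟨by linarith [hs.1], by linarith [hs.2]⟩ t
        ⟨by linarith [ht.1], by linarith [ht.2]⟩)
      (by
        have : (2 : ℝ) ^ n ≤ 2 ^ (j₀ + n) := pow_le_pow_right₀ (by norm_num) (by omega)
        linarith) w hw
    have := hj₀ (j₀ + n) (by omega)
    exact ⟨r, hr, by linarith⟩
  have descend : ∀ j, P (2 ^ (j₀ + j)) → P (2 ^ j₀) := by
    intro j
    induction j with
    | zero => exact id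
    | succ j ih => exact fun h => ih (step (j₀ + j) (by omega) h)
  obtain ⟨j, hj⟩ := start
  exact descend j hj a b le_rfl hab le_rfl

/-- A point of a geodesic cuts it into two halves. Since `L` is coarsely connected, it jumps at
some place from near the first half to near the second, and the point lies in between. -/
theorem exists_mem_dist_le (hL : IsSlimFamily L B) {K : ℝ} {u v : ℝ} {f : ℝ → X} (hK : 0 ≤ K)
    (hf : ∀ s ∈ Set.Icc u v, ∀ t ∈ Set.Icc u v, dist (f s) (f t) = |s - t|)
    (h : ∀ w ∈ L (f u) (f v), ∃ r ∈ Set.Icc u v, dist w (f r) ≤ K) {s : ℝ}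
    (hs : s ∈ Set.Icc u v) : ∃ w ∈ L (f u) (f v), dist (f s) w ≤ 3 * K + B := by
  have hB := hL.nonneg
  have huv := hs.1.trans hs.2
  let S : Set X := {a | ∃ t ∈ Set.Icc u s, dist a (f t) ≤ K}
  have huS : f u ∈ S := ⟨u, ⟨le_rfl, hs.1⟩, by simpa using hK⟩
  -- A jump of bounded length between the two halves takes place near `s`.
  have close : ∀ a c, dist a c ≤ B → a ∈ S → ∀ t ∈ Set.Icc s v, dist c (f t) ≤ K →
      dist (f s) a ≤ 3 * K + B := by
    rintro a c hac ⟨r, hr, har⟩ t ht hct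
    have h1 := hf r ⟨hr.1, hr.2.trans hs.2⟩ t ⟨hs.1.trans ht.1, ht.2⟩
    have h2 := hf s hs r ⟨hr.1, hr.2.trans hs.2⟩
    rw [abs_sub_comm, abs_of_nonneg (by linarith [hr.2, ht.1])] at h1
    rw [abs_of_nonneg (by linarith [hr.2])] at h2
    have h3 := dist_triangle4 (f r) a c (f t)
    rw [dist_comm (f r) a] at h3
    have h4 := dist_triangle_right (f s) a (f r)
    linarith [ht.1]
  by_cases hvS : f v ∈ S
  · exact ⟨f v, hL.right_mem _ _,
      close (f v) (f v) (by simpa using hB) hvS v ⟨hs.2, le_rfl⟩ (by simpa using hK)⟩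
  · obtain ⟨a, ha, c, hc, haS, hcS, hac⟩ := hL.exists_jump _ _ S huS hvS
    obtain ⟨t, ht, hct⟩ := h c hc
    have hst : s ≤ t := by
      by_contra hst
      exact hcS ⟨t, ⟨ht.1, (not_le.1 hst).le⟩, hct⟩
    exact ⟨a, ha, close a c hac haS t ⟨hst, ht.2⟩ hct⟩

theorem isGromovHyperbolic (hL : IsSlimFamily L B) : IsGromovHyperbolic X := by
  obtain ⟨K, hK, h⟩ := hL.exists_forall_exists_dist_le
  have hB := hL.nonneg
  have toGeodesic : ∀ {x y : X} {S : Set X}, IsGeodesic x y S →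
      ∀ w ∈ L x y, ∃ p ∈ S, dist w p ≤ K := by
    rintro _ _ _ ⟨u, v, f, huv, rfl, rfl, hf, rfl⟩ w hw
    obtain ⟨r, hr, hwr⟩ := h u v f huv hf w hw
    exact ⟨f r, ⟨r, hr, rfl⟩, hwr⟩
  have ofGeodesic : ∀ {x y : X} {S : Set X}, IsGeodesic x y S →
      ∀ p ∈ S, ∃ w ∈ L x y, dist p w ≤ 3 * K + B := by
    rintro _ _ _ ⟨u, v, f, huv, rfl, rfl, hf, rfl⟩ _ ⟨s, hs, rfl⟩
    exact hL.exists_mem_dist_le hK hf (h u v f huv hf) hs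
  have side : ∀ {x y z : X} {k g h : Set X}, IsGeodesic x y k → IsGeodesic y z g →
      IsGeodesic z x h → k ⊆ Metric.cthickening (4 * K + 2 * B) (g ∪ h) := by
    intro x y z k g h hk hg hh p hp
    obtain ⟨w, hw, hpw⟩ := ofGeodesic hk p hp
    obtain ⟨w', hw', hww'⟩ := hL.slim _ _ z w hw
    have hq : ∃ q ∈ g ∪ h, dist w' q ≤ K := by
      rcases hw' with hw' | hw'
      · obtain ⟨q, hq, hd⟩ := toGeodesic hg w' hw'
        exact ⟨q, Or.inl hq, hd⟩
      · obtain ⟨q, hq, hd⟩ := toGeodesic hh w' hw'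
        exact ⟨q, Or.inr hq, hd⟩
    obtain ⟨q, hq, hd⟩ := hq
    exact Metric.mem_cthickening_of_dist_le p q _ _ hq (by linarith [dist_triangle4 p w w' q])
  exact ⟨4 * K + 2 * B, by positivity, fun x y z k g h hk hg hh =>
    ⟨side hk hg hh, side hg hh hk, side hh hk hg⟩⟩

end IsSlimFamily

variable {α β : Type*}

/-! ### Distances in the metric graph -/

namespace Point

variable {G : Graph α β}

theorem footDist_le_one (p : Point G) (i : Bool) : p.footDist i ≤ 1 := by
  rcases p with v | ⟨e, t, h0, h1⟩ <;> cases i <;> simp [footDist] <;> linarith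

variable [hG : Fact G.toSimpleGraph.Preconnected]

theorem dist_vertex_vertex (x y : V(G)) :
    dist (vertex x) (vertex y) = G.toSimpleGraph.dist x y := by
  obtain ⟨i, j, h⟩ := exists_outerDist_eq (vertex x) (vertex y)
  change outerDist (vertex x) (vertex y) = _
  simpa [foot, footDist] using h

theorem dist_vertex_foot_le (p : Point G) (i : Bool) :
    dist p (vertex (p.foot i)) ≤ p.footDist i := by
  have h := (pathDist_le_outerDist p (vertex (p.foot i))).trans
    (outerDist_le p (vertex (p.foot i)) i false)
  rw [show (vertex (p.foot i)).foot false = p.foot i from rfl,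
    show (vertex (p.foot i)).footDist false = 0 from rfl, SimpleGraph.dist_self, Nat.cast_zero,
    add_zero, add_zero] at h
  exact h

theorem dist_vertex_foot_le_one (p : Point G) (i : Bool) : dist p (vertex (p.foot i)) ≤ 1 :=
  (dist_vertex_foot_le p i).trans (footDist_le_one p i)

theorem dist_vertex_le_one_of_adj {x y : V(G)} (h : G.Adj x.1 y.1) :
    dist (vertex x) (vertex y) ≤ 1 := by
  by_cases hxy : x = y
  · simp [hxy]
  · rw [dist_vertex_vertex,
      SimpleGraph.dist_eq_one_iff_adj.2 (show G.toSimpleGraph.Adj x y from ⟨hxy, h⟩), Nat.cast_one]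

end Point

theorem foot_mem_carrier {G H : Graph α β} (hH : H ≤ G) {p : Point G} (hp : p ∈ carrier G H)
    (i : Bool) : Point.vertex (p.foot i) ∈ carrier G H := by
  rcases p with v | ⟨e, t⟩
  · exact hp
  · have h := (hH.isLink_iff hp).2 (isLink_source_target e)
    cases i
    · exact h.left_mem
    · exact h.right_mem

theorem exists_dist_lt_of_mem_cthickening {X : Type*} [MetricSpace X] {δ : ℝ} (hδ : 0 ≤ δ)
    {S : Set X} {p : X} (hp : p ∈ Metric.cthickening δ S) : ∃ q ∈ S, dist p q < δ + 1 :=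
  Metric.mem_thickening_iff.1
    (Metric.cthickening_subset_thickening' (by linarith) (lt_add_one δ) S hp)

/-! ### Slim families of connected subgraphs imply hyperbolicity -/

section

variable {G : Graph α β} [hG : Fact G.toSimpleGraph.Preconnected] {M : ℝ}
  {g : Sym2 V(G) → Graph α β}

/-- Slim triangles carry the local bound along a walk, so the subgraph of two vertices stays near
them, at a distance bounded linearly in the length of the walk. -/
theorem dist_le_of_walk (hM : 0 ≤ M)
    (hg : ∀ x y : V(G), x.1 ∈ V(g s(x, y)) ∧ y.1 ∈ V(g s(x, y)))
    (hloc : ∀ x y : V(G), dist (Point.vertex x) (Point.vertex y) ≤ 1 →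
      Metric.ediam (carrier G (g s(x, y))) ≤ ENNReal.ofReal M)
    (hslim : ∀ x y z : V(G), carrier G (g s(x, y)) ⊆
      Metric.cthickening M (carrier G (g s(y, z)) ∪ carrier G (g s(z, x))))
    {x y : V(G)} (W : G.toSimpleGraph.Walk x y) :
    ∀ v ∈ carrier G (g s(x, y)), dist (Point.vertex x) v ≤ (W.length + 1) * (2 * M + 2) := by
  have near : ∀ x y : V(G), dist (Point.vertex x) (Point.vertex y) ≤ 1 →
      ∀ v ∈ carrier G (g s(x, y)), dist (Point.vertex x) v ≤ M := by
    intro x y hxy v hv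
    have h : edist (Point.vertex x) v ≤ ENNReal.ofReal M :=
      (Metric.edist_le_ediam_of_mem (show Point.vertex x ∈ carrier G (g s(x, y)) from (hg x y).1)
        hv).trans (hloc x y hxy)
    rwa [edist_dist, ENNReal.ofReal_le_ofReal_iff hM] at h
  induction W with
  | nil =>
    intro v hv
    have := near _ _ (by simp) v hv
    simp only [SimpleGraph.Walk.length_nil, Nat.cast_zero]
    linarith
  | @cons x z y hadj W ih =>
    intro v hv
    have hxz : dist (Point.vertex x) (Point.vertex z) ≤ 1 :=
      Point.dist_vertex_le_one_of_adj hadj.2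
    obtain ⟨w, hw, hvw⟩ := exists_dist_lt_of_mem_cthickening hM (hslim x y z hv)
    have h1 := dist_triangle_right (Point.vertex x) v w
    have h0 : 0 ≤ (W.length : ℝ) * (2 * M + 2) := by positivity
    rw [SimpleGraph.Walk.length_cons]
    push_cast
    rcases hw with hw | hw
    · rw [Sym2.eq_swap] at hw
      have h2 := ih w hw
      have h3 := dist_triangle (Point.vertex x) (Point.vertex z) w
      linarith
    · rw [Sym2.eq_swap] at hw
      have h2 := near x z hxz w hw
      linarith

/-- The subgraphs of the criterion, extended to a slim family that is indexed by all pairs of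
points: each point is replaced by a foot, and the two points themselves are added. -/
theorem isSlimFamily_carrier (hM : 0 ≤ M)
    (hg : ∀ x y : V(G), g s(x, y) ≤ G ∧ (g s(x, y)).toSimpleGraph.Connected ∧
      x.1 ∈ V(g s(x, y)) ∧ y.1 ∈ V(g s(x, y)))
    (hloc : ∀ x y : V(G), dist (Point.vertex x) (Point.vertex y) ≤ 1 →
      Metric.ediam (carrier G (g s(x, y))) ≤ ENNReal.ofReal M)
    (hslim : ∀ x y z : V(G), carrier G (g s(x, y)) ⊆
      Metric.cthickening M (carrier G (g s(y, z)) ∪ carrier G (g s(z, x)))) :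
    IsSlimFamily
      (fun p q : Point G => carrier G (g s(p.foot false, q.foot false)) ∪ {p, q})
      (4 * (2 * M + 2) + 1) where
  nonneg := by positivity
  symm p q := by rw [Sym2.eq_swap, Set.pair_comm]
  right_mem p q := by simp
  dist_le p q hpq v hv := by
    rcases hv with hv | rfl | rfl
    · -- The feet of `p` and `q` are at distance at most `3`.
      obtain ⟨W, hW⟩ := (hG.out (p.foot false) (q.foot false)).exists_walk_length_eq_dist
      have h1 := dist_le_of_walk hM (fun x y => (hg x y).2.2) hloc hslim W v hv
      have h2 := Point.dist_vertex_foot_le_one p false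
      have h3 := Point.dist_vertex_foot_le_one q false
      have h4 := dist_triangle4 (Point.vertex (p.foot false)) p q (Point.vertex (q.foot false))
      rw [dist_comm _ p, Point.dist_vertex_vertex, ← hW] at h4
      have h5 : (W.length : ℝ) ≤ 3 := by linarith
      have h6 := dist_triangle p (Point.vertex (p.foot false)) v
      nlinarith
    · rw [dist_self]; positivity
    · linarith
  slim p q r v hv := by
    rcases hv with hv | rfl | rfl
    · obtain ⟨w, hw, hvw⟩ := exists_dist_lt_of_mem_cthickening hM
        (hslim (p.foot false) (q.foot false) (r.foot false) hv)
      exact ⟨w, hw.imp Or.inl Or.inl, by linarith⟩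
    · exact ⟨v, by simp, by rw [dist_self]; positivity⟩
    · exact ⟨v, by simp, by rw [dist_self]; positivity⟩
  exists_jump p q S hp hq := by
    obtain ⟨hle, hconn, hx, hy⟩ := hg (p.foot false) (q.foot false)
    by_cases hpS : Point.vertex (p.foot false) ∈ S
    · by_cases hqS : Point.vertex (q.foot false) ∈ S
      · refine ⟨_, Or.inl hy, q, by simp, hqS, hq, ?_⟩
        rw [dist_comm]
        linarith [Point.dist_vertex_foot_le_one q false]
      · obtain ⟨W⟩ := hconn.preconnected ⟨_, hx⟩ ⟨_, hy⟩
        obtain ⟨d, -, h1, h2⟩ := W.exists_boundary_dart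
          {v | Point.vertex ⟨v.1, hle.vertexSet_mono v.2⟩ ∈ S} hpS hqS
        refine ⟨_, Or.inl d.fst.2, _, Or.inl d.snd.2, h1, h2, ?_⟩
        have h3 := d.adj.2.mono hle
        have h4 := Point.dist_vertex_le_one_of_adj (G := G)
          (x := ⟨d.fst.1, hle.vertexSet_mono d.fst.2⟩)
          (y := ⟨d.snd.1, hle.vertexSet_mono d.snd.2⟩) h3
        linarith
    · exact ⟨p, by simp, _, Or.inl hx, hp, hpS, by
        linarith [Point.dist_vertex_foot_le_one p false]⟩

end

/-! ### Geodesics in the metric graph -/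

/-- `f`, restricted to `[0, l]`, is a path from `p` to `q` that does not expand distances. -/
structure IsShortPath {X : Type*} [MetricSpace X] (p q : X) (l : ℝ) (f : ℝ → X) : Prop where
  nonneg : 0 ≤ l
  map_zero : f 0 = p
  map_length : f l = q
  dist_le : ∀ s ∈ Set.Icc 0 l, ∀ t ∈ Set.Icc 0 l, dist (f s) (f t) ≤ |s - t|

namespace IsShortPath

variable {X : Type*} [MetricSpace X] {p q r : X} {l m : ℝ} {f f' : ℝ → X}

theorem symm (hf : IsShortPath p q l f) : IsShortPath q p l (fun t => f (l - t)) where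
  nonneg := hf.nonneg
  map_zero := by simp [hf.map_length]
  map_length := by simp [hf.map_zero]
  dist_le s hs t ht := by
    have h := hf.dist_le (l - s) ⟨by linarith [hs.2], by linarith [hs.1]⟩ (l - t)
      ⟨by linarith [ht.2], by linarith [ht.1]⟩
    rwa [sub_sub_sub_cancel_left, abs_sub_comm] at h

theorem exists_trans (hf : IsShortPath p q l f) (hf' : IsShortPath q r m f') :
    ∃ g, IsShortPath p r (l + m) g ∧ g l = q := by
  have hl := hf.nonneg
  have hm := hf'.nonneg
  let g : ℝ → X := fun t => if t ≤ l then f t else f' (t - l)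
  have g_left : ∀ t, t ≤ l → g t = f t := fun t ht => if_pos ht
  have g_right : ∀ t, l ≤ t → g t = f' (t - l) := by
    intro t ht
    rcases ht.eq_or_lt with rfl | ht
    · rw [g_left l le_rfl, sub_self, hf.map_length, hf'.map_zero]
    · exact if_neg ht.not_ge
  -- Across the junction, the two pieces are compared through the common point `q`.
  have mixed : ∀ s ∈ Set.Icc 0 l, ∀ t ∈ Set.Icc l (l + m), dist (g s) (g t) ≤ |s - t| := by
    intro s hs t ht
    rw [g_left s hs.2, g_right t ht.1]
    have h1 := hf.dist_le s hs l ⟨hl, le_rfl⟩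
    have h2 := hf'.dist_le 0 ⟨le_rfl, hm⟩ (t - l) ⟨by linarith [ht.1], by linarith [ht.2]⟩
    rw [hf.map_length, abs_sub_comm, abs_of_nonneg (by linarith [hs.2])] at h1
    rw [hf'.map_zero, abs_sub_comm, abs_of_nonneg (by linarith [ht.1])] at h2
    rw [abs_sub_comm, abs_of_nonneg (by linarith [hs.2, ht.1])]
    linarith [dist_triangle (f s) q (f' (t - l))]
  refine ⟨g, ⟨by linarith, by rw [g_left 0 hl, hf.map_zero], ?_, fun s hs t ht => ?_⟩,
    by rw [g_left l le_rfl, hf.map_length]⟩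
  · rw [g_right _ (by linarith), add_sub_cancel_left, hf'.map_length]
  · rcases le_total s l with h | h <;> rcases le_total t l with h' | h'
    · rw [g_left s h, g_left t h']
      exact hf.dist_le s ⟨hs.1, h⟩ t ⟨ht.1, h'⟩
    · exact mixed s ⟨hs.1, h⟩ t ⟨h', ht.2⟩
    · rw [dist_comm, abs_sub_comm]
      exact mixed t ⟨ht.1, h'⟩ s ⟨h, hs.2⟩
    · rw [g_right s h, g_right t h']
      have h1 := hf'.dist_le (s - l) ⟨by linarith, by linarith [hs.2]⟩ (t - l)
        ⟨by linarith, by linarith [ht.2]⟩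
      rwa [sub_sub_sub_cancel_right] at h1

/-- Two points of a shortest path cannot be closer than their parameters, since the path between
its ends could otherwise be shortened. -/
theorem isGeodesic (hf : IsShortPath p q l f) (hl : l ≤ dist p q) :
    IsGeodesic p q (f '' Set.Icc 0 l) := by
  refine ⟨0, l, f, hf.nonneg, hf.map_zero, hf.map_length, fun s hs t ht => ?_, rfl⟩
  refine le_antisymm (hf.dist_le s hs t ht) ?_
  have key : ∀ s ∈ Set.Icc 0 l, ∀ t ∈ Set.Icc 0 l, t - s ≤ dist (f s) (f t) := by
    intro s hs t ht
    have h1 := hf.dist_le 0 ⟨le_rfl, hf.nonneg⟩ s hs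
    have h2 := hf.dist_le t ht l ⟨hf.nonneg, le_rfl⟩
    rw [hf.map_zero, abs_sub_comm, abs_of_nonneg (by linarith [hs.1])] at h1
    rw [hf.map_length, abs_sub_comm, abs_of_nonneg (by linarith [ht.2])] at h2
    linarith [dist_triangle4 p (f s) (f t) q]
  rw [abs_le']
  refine ⟨?_, by linarith [key s hs t ht]⟩
  rw [dist_comm]
  exact key t ht s hs

end IsShortPath

section

variable {G : Graph α β} [hG : Fact G.toSimpleGraph.Preconnected]

theorem exists_isShortPath_edge (e : E(G)) :
    ∃ f, IsShortPath (Point.vertex (source e)) (Point.vertex (target e)) 1 f := by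
  let f : ℝ → Point G := fun t =>
    if h : t ∈ Set.Ioo (0 : ℝ) 1 then .inner e ⟨t, h⟩
    else if t ≤ 0 then .vertex (source e) else .vertex (target e)
  have f_zero : f 0 = Point.vertex (source e) := by simp [f]
  have f_one : f 1 = Point.vertex (target e) := by simp [f, not_le.2 one_pos]
  have f_inner : ∀ t (h : t ∈ Set.Ioo (0 : ℝ) 1), f t = .inner e ⟨t, h⟩ := fun t h => dif_pos h
  have ends : dist (Point.vertex (source e)) (Point.vertex (target e)) ≤ 1 :=
    Point.dist_vertex_le_one_of_adj ⟨e.1, isLink_source_target e⟩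
  have key : ∀ s t, 0 ≤ s → s ≤ t → t ≤ 1 → dist (f s) (f t) ≤ t - s := by
    intro s t hs hst ht
    rcases hst.eq_or_lt with rfl | hst
    · simp
    rcases hs.eq_or_lt with rfl | hs
    · rcases ht.eq_or_lt with rfl | ht
      · rw [f_zero, f_one]; linarith
      · rw [f_zero, f_inner t ⟨hst, ht⟩, dist_comm]
        exact (Point.dist_vertex_foot_le (Point.inner e ⟨t, hst, ht⟩ : Point G) false).trans_eq
          (sub_zero t).symm
    · rcases ht.eq_or_lt with rfl | ht
      · rw [f_one, f_inner s ⟨hs, hst⟩]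
        exact Point.dist_vertex_foot_le (Point.inner e ⟨s, hs, hst⟩ : Point G) true
      · rw [f_inner s ⟨hs, hst.trans ht⟩, f_inner t ⟨hs.trans hst, ht⟩]
        refine (Point.pathDist_inner_le e _ _).trans_eq ?_
        rw [abs_sub_comm, abs_of_nonneg (by simpa using hst.le)]
  refine ⟨f, zero_le_one, f_zero, f_one, fun s hs t ht => ?_⟩
  rcases le_total s t with h | h
  · rw [abs_sub_comm, abs_of_nonneg (by linarith)]
    exact key s t hs.1 h ht.2
  · rw [dist_comm, abs_of_nonneg (by linarith)]
    exact key t s ht.1 h hs.2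

theorem exists_isShortPath_of_walk {x y : V(G)} (W : G.toSimpleGraph.Walk x y) :
    ∃ f, IsShortPath (Point.vertex x) (Point.vertex y) W.length f := by
  induction W with
  | nil =>
    rename_i x
    exact ⟨fun _ => Point.vertex x, by simp, rfl, rfl, by simp⟩
  | @cons x z y hadj W ih =>
    obtain ⟨f', hf'⟩ := ih
    obtain ⟨e, he⟩ := hadj.2
    have hstep : ∃ f, IsShortPath (Point.vertex x) (Point.vertex z) 1 f := by
      obtain ⟨f, hf⟩ := exists_isShortPath_edge (⟨e, he.edge_mem⟩ : E(G))
      rcases he.eq_and_eq_or_eq_and_eq (isLink_source_target ⟨e, he.edge_mem⟩) with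
        ⟨h1, h2⟩ | ⟨h1, h2⟩
      · rw [← Subtype.ext h1, ← Subtype.ext h2] at hf
        exact ⟨f, hf⟩
      · rw [← Subtype.ext h1, ← Subtype.ext h2] at hf
        exact ⟨_, hf.symm⟩
    obtain ⟨f, hf⟩ := hstep
    obtain ⟨g, hg, -⟩ := hf.exists_trans hf'
    refine ⟨g, ?_⟩
    rw [SimpleGraph.Walk.length_cons, Nat.cast_add, Nat.cast_one, add_comm]
    exact hg

/-- If the distances to `v` from `x` and `y` add up to the distance from `x` to `y`, some geodesic
from `x` to `y` passes through `v`. -/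
theorem exists_isGeodesic_mem {x y v : V(G)}
    (hv : G.toSimpleGraph.dist x v + G.toSimpleGraph.dist v y = G.toSimpleGraph.dist x y) :
    ∃ S, IsGeodesic (Point.vertex x) (Point.vertex y) S ∧ Point.vertex v ∈ S := by
  obtain ⟨W, hW⟩ := (hG.out x v).exists_walk_length_eq_dist
  obtain ⟨W', hW'⟩ := (hG.out v y).exists_walk_length_eq_dist
  obtain ⟨f, hf⟩ := exists_isShortPath_of_walk W
  obtain ⟨f', hf'⟩ := exists_isShortPath_of_walk W'
  obtain ⟨g, hg, hgv⟩ := hf.exists_trans hf'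
  refine ⟨_, hg.isGeodesic ?_, _, ⟨hf.nonneg, by linarith [hf'.nonneg]⟩, hgv⟩
  rw [Point.dist_vertex_vertex, ← hv, hW, hW', Nat.cast_add]

theorem exists_isGeodesic (x y : V(G)) :
    ∃ S, IsGeodesic (Point.vertex x) (Point.vertex y) S :=
  (exists_isGeodesic_mem (v := x) (by simp)).imp fun _ h => h.1

theorem IsGeodesic.dist_add_dist {X : Type*} [MetricSpace X] {x y p : X} {S : Set X}
    (hS : IsGeodesic x y S) (hp : p ∈ S) : dist x p + dist p y = dist x y := by
  obtain ⟨u, v, f, huv, rfl, rfl, hf, rfl⟩ := hS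
  obtain ⟨s, hs, rfl⟩ := hp
  rw [hf u ⟨le_rfl, huv⟩ s hs, hf s hs v ⟨huv, le_rfl⟩, hf u ⟨le_rfl, huv⟩ v ⟨huv, le_rfl⟩,
    abs_sub_comm, abs_of_nonneg (by linarith [hs.1]), abs_sub_comm,
    abs_of_nonneg (by linarith [hs.2]), abs_sub_comm, abs_of_nonneg (by linarith)]
  ring

/-- A point on a geodesic between two vertices has a foot on such a geodesic. -/
theorem exists_foot_dist_add_dist {x y : V(G)} {p : Point G}
    (hp : dist (Point.vertex x) p + dist p (Point.vertex y) =
      dist (Point.vertex x) (Point.vertex y)) :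
    ∃ i, G.toSimpleGraph.dist x (p.foot i) + G.toSimpleGraph.dist (p.foot i) y =
      G.toSimpleGraph.dist x y := by
  have h : ∀ z : V(G), ∃ i : Bool,
      dist (Point.vertex z) p = G.toSimpleGraph.dist z (p.foot i) + p.footDist i := by
    intro z
    have houter : dist (Point.vertex z) p = Point.outerDist (Point.vertex z) p := rfl
    obtain ⟨i, j, hij⟩ := Point.exists_outerDist_eq (Point.vertex z) p
    exact ⟨j, by simpa [houter, Point.footDist, Point.foot] using hij⟩
  obtain ⟨i, hi⟩ := h x
  obtain ⟨j, hj⟩ := h y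
  refine ⟨i, le_antisymm ?_ ((hG.out x (p.foot i)).dist_triangle_left y)⟩
  have h1 := (hG.out (p.foot i) (p.foot j)).dist_triangle_left y
  have h2 := Point.dist_foot_le p i j
  rw [dist_comm p, hi, hj, Point.dist_vertex_vertex, SimpleGraph.dist_comm (u := y)] at hp
  have h3 : (G.toSimpleGraph.dist (p.foot i) y : ℝ) ≤
    G.toSimpleGraph.dist (p.foot i) (p.foot j) + G.toSimpleGraph.dist (p.foot j) y := by
    exact_mod_cast h1
  have h4 : (G.toSimpleGraph.dist x (p.foot i) + G.toSimpleGraph.dist (p.foot i) y : ℝ) ≤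
    G.toSimpleGraph.dist x y := by linarith
  exact_mod_cast h4

end

/-! ### Hyperbolicity implies the existence of slim subgraphs -/

/-- The vertices that lie on some geodesic from `x` to `y`. -/
def interval (G : Graph α β) (x y : V(G)) : Set V(G) :=
  {v | G.toSimpleGraph.dist x v + G.toSimpleGraph.dist v y = G.toSimpleGraph.dist x y}

theorem interval_comm (G : Graph α β) (x y : V(G)) : interval G x y = interval G y x := by
  ext v
  change _ + _ = _ ↔ _ + _ = _
  rw [SimpleGraph.dist_comm (u := y) (v := x), SimpleGraph.dist_comm (u := y) (v := v),
    SimpleGraph.dist_comm (u := v) (v := x), add_comm]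

/-- The subgraph induced by the vertices that lie on some geodesic between the two given ones. -/
def intervalGraph (G : Graph α β) : Sym2 V(G) → Graph α β :=
  Sym2.lift ⟨fun x y => G.induce (Subtype.val '' interval G x y), fun x y => by
    dsimp only
    rw [interval_comm]⟩

section

variable {G : Graph α β}

theorem intervalGraph_mk (x y : V(G)) :
    intervalGraph G s(x, y) = G.induce (Subtype.val '' interval G x y) := rfl

theorem intervalGraph_le (x y : V(G)) : intervalGraph G s(x, y) ≤ G := by
  rw [intervalGraph_mk, Graph.induce_le_iff]
  rintro _ ⟨v, -, rfl⟩
  exact v.2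

theorem vertex_mem_carrier_intervalGraph {x y v : V(G)} :
    Point.vertex v ∈ carrier G (intervalGraph G s(x, y)) ↔ v ∈ interval G x y := by
  change v.1 ∈ Subtype.val '' interval G x y ↔ _
  simp

theorem left_mem_interval (x y : V(G)) : x ∈ interval G x y := by simp [interval]

theorem right_mem_interval (x y : V(G)) : y ∈ interval G x y := by simp [interval]

theorem mem_vertexSet_intervalGraph {x y v : V(G)} (hv : v ∈ interval G x y) :
    v.1 ∈ V(intervalGraph G s(x, y)) := ⟨v, hv, rfl⟩

variable [hG : Fact G.toSimpleGraph.Preconnected]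

theorem connected_intervalGraph (x y : V(G)) :
    (intervalGraph G s(x, y)).toSimpleGraph.Connected := by
  let H := intervalGraph G s(x, y)
  -- On a shortest walk to `x` from another vertex of the interval, the next vertex lies in the
  -- interval, too.
  have key : ∀ (n : ℕ) (v : V(G)) (hv : v ∈ interval G x y), G.toSimpleGraph.dist v x = n →
      H.toSimpleGraph.Reachable ⟨v.1, mem_vertexSet_intervalGraph hv⟩
        ⟨x.1, mem_vertexSet_intervalGraph (left_mem_interval x y)⟩ := by
    intro n
    induction n with
    | zero =>
      intro v hv hn
      obtain rfl := (hG.out v x).dist_eq_zero_iff.1 hn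
      rfl
    | succ n ih =>
      intro v hv hn
      obtain ⟨W, hW⟩ := (hG.out v x).exists_walk_length_eq_dist
      cases W with
      | nil => simp at hn
      | @cons _ u _ hadj W =>
        rw [SimpleGraph.Walk.length_cons, hn] at hW
        have h1 := SimpleGraph.dist_le W
        have h2 := SimpleGraph.dist_eq_one_iff_adj.2 hadj
        have h3 := (hG.out u v).dist_triangle_left y
        have h4 := (hG.out x u).dist_triangle_left y
        have h5 : G.toSimpleGraph.dist u v = G.toSimpleGraph.dist v u := SimpleGraph.dist_comm
        have h6 : G.toSimpleGraph.dist u x = G.toSimpleGraph.dist x u := SimpleGraph.dist_comm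
        have h7 : G.toSimpleGraph.dist v x = G.toSimpleGraph.dist x v := SimpleGraph.dist_comm
        have h8 : G.toSimpleGraph.dist x v + G.toSimpleGraph.dist v y =
          G.toSimpleGraph.dist x y := hv
        have hu : u ∈ interval G x y := by
          change G.toSimpleGraph.dist x u + G.toSimpleGraph.dist u y = G.toSimpleGraph.dist x y
          omega
        refine SimpleGraph.Reachable.trans (SimpleGraph.Adj.reachable ?_) (ih u hu (by omega))
        obtain ⟨e, he⟩ := hadj.2
        exact ⟨fun h => hadj.1 (Subtype.ext (congrArg (fun w : V(H) => w.1) h)),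
          e, he, ⟨v, hv, rfl⟩, ⟨u, hu, rfl⟩⟩
  have hx : ∀ v : V(H), H.toSimpleGraph.Reachable v
      ⟨x.1, mem_vertexSet_intervalGraph (left_mem_interval x y)⟩ := by
    rintro ⟨_, v, hv, rfl⟩
    exact key _ v hv rfl
  have : Nonempty V(H) := ⟨⟨x.1, mem_vertexSet_intervalGraph (left_mem_interval x y)⟩⟩
  exact SimpleGraph.Connected.mk fun v w => (hx v).trans (hx w).symm

theorem exists_interval_of_mem_carrier {x y : V(G)} {p : Point G}
    (hp : p ∈ carrier G (intervalGraph G s(x, y))) :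
    ∃ v ∈ interval G x y, dist p (Point.vertex v) ≤ 1 :=
  ⟨p.foot false, vertex_mem_carrier_intervalGraph.1
    (foot_mem_carrier (intervalGraph_le x y) hp false), Point.dist_vertex_foot_le_one p false⟩

theorem ediam_carrier_intervalGraph_le {x y : V(G)}
    (hxy : dist (Point.vertex x) (Point.vertex y) ≤ 1) :
    Metric.ediam (carrier G (intervalGraph G s(x, y))) ≤ ENNReal.ofReal 4 := by
  have key : ∀ p ∈ carrier G (intervalGraph G s(x, y)), dist p (Point.vertex x) ≤ 2 := by
    intro p hp
    obtain ⟨v, hv, hpv⟩ := exists_interval_of_mem_carrier hp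
    have h1 : G.toSimpleGraph.dist v x ≤ G.toSimpleGraph.dist x y := by
      rw [SimpleGraph.dist_comm, ← hv]
      exact Nat.le_add_right _ _
    have h2 : dist (Point.vertex v) (Point.vertex x) ≤ 1 := by
      refine le_trans ?_ hxy
      rw [Point.dist_vertex_vertex, Point.dist_vertex_vertex]
      exact_mod_cast h1
    linarith [dist_triangle p (Point.vertex v) (Point.vertex x)]
  refine Metric.ediam_le fun p hp q hq => ?_
  rw [edist_dist]
  exact ENNReal.ofReal_le_ofReal
    (by linarith [key p hp, key q hq, dist_triangle_right p q (Point.vertex x)])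

theorem carrier_intervalGraph_subset {δ : ℝ} (hδ : 0 ≤ δ) (h : IsHyperbolic δ (Point G))
    (x y z : V(G)) :
    carrier G (intervalGraph G s(x, y)) ⊆ Metric.cthickening (δ + 4)
      (carrier G (intervalGraph G s(y, z)) ∪ carrier G (intervalGraph G s(z, x))) := by
  intro p hp
  obtain ⟨v, hv, hpv⟩ := exists_interval_of_mem_carrier hp
  obtain ⟨k, hk, hvk⟩ := exists_isGeodesic_mem hv
  obtain ⟨k₁, hk₁⟩ := exists_isGeodesic y z
  obtain ⟨k₂, hk₂⟩ := exists_isGeodesic z x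
  obtain ⟨q, hq, hvq⟩ := exists_dist_lt_of_mem_cthickening hδ ((h _ _ _ _ _ _ hk hk₁ hk₂).1 hvk)
  have hw : ∃ i, Point.vertex (q.foot i) ∈
      carrier G (intervalGraph G s(y, z)) ∪ carrier G (intervalGraph G s(z, x)) := by
    rcases hq with hq | hq
    · obtain ⟨i, hi⟩ := exists_foot_dist_add_dist (hk₁.dist_add_dist hq)
      exact ⟨i, Or.inl (vertex_mem_carrier_intervalGraph.2 hi)⟩
    · obtain ⟨i, hi⟩ := exists_foot_dist_add_dist (hk₂.dist_add_dist hq)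
      exact ⟨i, Or.inr (vertex_mem_carrier_intervalGraph.2 hi)⟩
  obtain ⟨i, hi⟩ := hw
  refine Metric.mem_cthickening_of_dist_le p _ _ _ hi ?_
  have h1 := Point.dist_vertex_foot_le_one q i
  have h2 := dist_triangle4 p (Point.vertex v) q (Point.vertex (q.foot i))
  linarith

end

end UnitEdgeGraph

theorem mainTheorem9 {α β : Type*} (G : Graph α β) [Fact G.toSimpleGraph.Preconnected] :
    UnitEdgeGraph.IsGromovHyperbolic (UnitEdgeGraph.Point G) ↔
      ∃ M : ℝ, 0 ≤ M ∧ ∃ g : Sym2 V(G) → Graph α β,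
        (∀ x y : V(G), g s(x, y) ≤ G ∧ (g s(x, y)).toSimpleGraph.Connected ∧
          x.1 ∈ V(g s(x, y)) ∧ y.1 ∈ V(g s(x, y))) ∧
        (∀ x y : V(G),
          dist (UnitEdgeGraph.Point.vertex x) (UnitEdgeGraph.Point.vertex y) ≤ 1 →
            Metric.ediam (UnitEdgeGraph.carrier G (g s(x, y))) ≤ ENNReal.ofReal M) ∧
        (∀ x y z : V(G),
          UnitEdgeGraph.carrier G (g s(x, y)) ⊆
            Metric.cthickening M
              (UnitEdgeGraph.carrier G (g s(y, z)) ∪ UnitEdgeGraph.carrier G (g s(z, x)))) := by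
  constructor
  · rintro ⟨δ, hδ, h⟩
    refine ⟨δ + 4, by linarith, UnitEdgeGraph.intervalGraph G, fun x y => ?_, fun x y hxy => ?_,
      UnitEdgeGraph.carrier_intervalGraph_subset hδ h⟩
    · exact ⟨UnitEdgeGraph.intervalGraph_le x y, UnitEdgeGraph.connected_intervalGraph x y,
        UnitEdgeGraph.mem_vertexSet_intervalGraph (UnitEdgeGraph.left_mem_interval x y),
        UnitEdgeGraph.mem_vertexSet_intervalGraph (UnitEdgeGraph.right_mem_interval x y)⟩
    · exact (UnitEdgeGraph.ediam_carrier_intervalGraph_le hxy).trans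
        (ENNReal.ofReal_le_ofReal (by linarith))
  · rintro ⟨M, hM, g, hg, hloc, hslim⟩
    exact (UnitEdgeGraph.isSlimFamily_carrier hM hg hloc hslim).isGromovHyperbolic
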